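/- An MTL-algebra is a prelinear commutative bounded integral residuated lattice $(A,*,\Rightarrow,\sqcap,\sqcup,0,1)$. A DP-chain is a totally ordered MTL-algebra in which $x*y=0$ if $x,y<1$ and $x*y=\min\{x,y\}$ otherwise (the one-element algebra is included). Let $\mathbb{DP}$ be the variety of MTL-algebras generated by all DP-chains. Let DP be the logic that extends the logic MTL by the axiom schema $\varphi\vee\neg(\varphi\,\&\,\varphi)$; an axiomatic extension of DP is a logic obtained from DP by adding axiom schemata, and is identified with its set of theorems. Then: 1. Every proper subvariety of $\mathbb{DP}$ is generated by a single finite DP-chain. 2. Any two finite DP-chains of different cardinality generate distinct subvarieties of $\mathbb{DP}$. 3. Consequently, the subvarieties of $\mathbb{DP}$, ordered by inclusion, form a chain of order type $\omega+1$, and so do the axiomatic extensions of DP (the inconsistent one included), ordered by reverse inclusion of their sets of theorems. -/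

import Mathlib

universe u

/-- MTL-algebras: prelinear commutative bounded integral residuated lattices. The monoidal
operation is `*`, its residuum is `⇨`, and `0`, `1` of the algebra are `⊥` and `1 = ⊤`. -/
class MTLAlgebra (A : Type*) extends CommMonoid A, Lattice A, BoundedOrder A, HImp A where
  /-- residuation -/
  mul_le_iff_le_himp : ∀ x y z : A, x * y ≤ z ↔ x ≤ y ⇨ z
  /-- integrality -/
  one_eq_top : (1 : A) = ⊤
  /-- prelinearity -/
  prelinear : ∀ x y : A, (x ⇨ y) ⊔ (y ⇨ x) = 1

/-- Bundled MTL-algebras (needed to speak about classes of algebras). -/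
structure MTLAlg : Type (u + 1) where
  /-- the universe of the algebra -/
  carrier : Type u
  /-- its operations -/
  [str : MTLAlgebra carrier]

namespace MTLAlg

instance : CoeSort MTLAlg.{u} (Type u) := ⟨MTLAlg.carrier⟩

instance (A : MTLAlg.{u}) : MTLAlgebra A := A.str

/-- Drastic product chains: totally ordered MTL-algebras in which `x * y` is `0` if `x, y < 1`,
and `min {x, y}` otherwise. -/
def IsDPChain (A : MTLAlg.{u}) : Prop :=
  (∀ x y : A, x ≤ y ∨ y ≤ x) ∧
  (∀ x y : A, x < 1 ∧ y < 1 → x * y = ⊥) ∧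
  (∀ x y : A, ¬ (x < 1 ∧ y < 1) → x * y = x ⊓ y)

end MTLAlg

/-- Formulas of MTL over countably many variables, in the language `{&, ∧, →, ⊥}`. -/
inductive MTLFormula : Type
  | var : ℕ → MTLFormula
  | bot : MTLFormula
  | conj : MTLFormula → MTLFormula → MTLFormula
  | inf : MTLFormula → MTLFormula → MTLFormula
  | imp : MTLFormula → MTLFormula → MTLFormula

namespace MTLFormula

/-- `¬φ := φ → ⊥` -/
def neg (φ : MTLFormula) : MTLFormula := imp φ bot

/-- `⊤ := ¬⊥` -/
def top : MTLFormula := neg bot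

/-- `φ ∨ ψ := ((φ → ψ) → ψ) ∧ ((ψ → φ) → φ)` -/
def sup (φ ψ : MTLFormula) : MTLFormula :=
  inf (imp (imp φ ψ) ψ) (imp (imp ψ φ) φ)

/-- Simultaneous substitution of formulas for variables. -/
def subst (σ : ℕ → MTLFormula) : MTLFormula → MTLFormula
  | var n => σ n
  | bot => bot
  | conj φ ψ => conj (subst σ φ) (subst σ ψ)
  | inf φ ψ => inf (subst σ φ) (subst σ ψ)
  | imp φ ψ => imp (subst σ φ) (subst σ ψ)

/-- The value of a formula (that is, of a term) in an MTL-algebra. -/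
def eval {A : Type*} [MTLAlgebra A] (v : ℕ → A) : MTLFormula → A
  | var n => v n
  | bot => ⊥
  | conj φ ψ => eval v φ * eval v ψ
  | inf φ ψ => eval v φ ⊓ eval v ψ
  | imp φ ψ => eval v φ ⇨ eval v ψ

/-- The derived constant `⊤` denotes the element `1` of the algebra. -/
theorem eval_top {A : Type*} [MTLAlgebra A] (v : ℕ → A) : eval v top = 1 := by
  rw [MTLAlgebra.one_eq_top]
  refine top_le_iff.1 ?_
  change (⊤ : A) ≤ ⊥ ⇨ ⊥
  rw [← MTLAlgebra.mul_le_iff_le_himp, ← MTLAlgebra.one_eq_top, one_mul]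

/-- The derived disjunction denotes the join of the algebra. So all operations of MTL-algebras
are denoted by formulas, and formulas serve as the terms of the language of MTL-algebras. -/
theorem eval_sup {A : Type*} [MTLAlgebra A] (v : ℕ → A) (φ ψ : MTLFormula) :
    eval v (sup φ ψ) = eval v φ ⊔ eval v ψ := by
  change ((eval v φ ⇨ eval v ψ) ⇨ eval v ψ) ⊓ ((eval v ψ ⇨ eval v φ) ⇨ eval v φ) = _
  generalize eval v φ = x
  generalize eval v ψ = y
  have res := @MTLAlgebra.mul_le_iff_le_himp A _
  have mp : ∀ a b : A, (a ⇨ b) * a ≤ b := fun a b => (res _ _ _).2 le_rfl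
  have mono : ∀ a b c : A, a ≤ b → a * c ≤ b * c := fun a b c h =>
    (res _ _ _).2 (h.trans ((res _ _ _).1 le_rfl))
  have le1 : ∀ a : A, a ≤ 1 := fun a => by rw [MTLAlgebra.one_eq_top]; exact le_top
  have proj : ∀ a b : A, a * b ≤ b := fun a b => by simpa using mono a 1 b (le1 a)
  apply le_antisymm
  · have key : ∀ t : A, (x ⇨ y) * t ≤ x ⊔ y → (y ⇨ x) * t ≤ x ⊔ y → t ≤ x ⊔ y := by
      intro t h1 h2
      have h := sup_le ((res _ _ _).1 h1) ((res _ _ _).1 h2)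
      rw [MTLAlgebra.prelinear, ← res, one_mul] at h
      exact h
    refine key _ ?_ ?_
    · rw [mul_comm]
      exact ((mono _ _ _ inf_le_left).trans (mp _ _)).trans le_sup_right
    · rw [mul_comm]
      exact ((mono _ _ _ inf_le_right).trans (mp _ _)).trans le_sup_left
  · refine sup_le (le_inf ?_ ?_) (le_inf ?_ ?_)
    · rw [← res, mul_comm]; exact mp _ _
    · rw [← res, mul_comm]; exact proj _ _
    · rw [← res, mul_comm]; exact proj _ _
    · rw [← res, mul_comm]; exact mp _ _

/-- The axiom schemata of the logic MTL. -/
inductive IsMTLAxiom : MTLFormula → Prop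
  | trans (φ ψ χ) : IsMTLAxiom (imp (imp φ ψ) (imp (imp ψ χ) (imp φ χ)))
  | conj_left (φ ψ) : IsMTLAxiom (imp (conj φ ψ) φ)
  | conj_comm (φ ψ) : IsMTLAxiom (imp (conj φ ψ) (conj ψ φ))
  | inf_left (φ ψ) : IsMTLAxiom (imp (inf φ ψ) φ)
  | inf_comm (φ ψ) : IsMTLAxiom (imp (inf φ ψ) (inf ψ φ))
  | conj_imp (φ ψ) : IsMTLAxiom (imp (conj φ (imp φ ψ)) (inf φ ψ))
  | uncurry (φ ψ χ) : IsMTLAxiom (imp (imp φ (imp ψ χ)) (imp (conj φ ψ) χ))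
  | curry (φ ψ χ) : IsMTLAxiom (imp (imp (conj φ ψ) χ) (imp φ (imp ψ χ)))
  | prelin (φ ψ χ) :
      IsMTLAxiom (imp (imp (imp φ ψ) χ) (imp (imp (imp ψ φ) χ) χ))
  | bot_imp (φ) : IsMTLAxiom (imp bot φ)

/-- Theorems of the axiomatic extension of MTL by the axiom schemata `Γ`: the formulas derivable
by modus ponens from the axioms of MTL and the substitution instances of members of `Γ`. -/
inductive Derivable (Γ : Set MTLFormula) : MTLFormula → Prop
  | ax {φ : MTLFormula} : IsMTLAxiom φ → Derivable Γ φ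
  | inst {φ : MTLFormula} (σ : ℕ → MTLFormula) : φ ∈ Γ → Derivable Γ (subst σ φ)
  | mp {φ ψ : MTLFormula} : Derivable Γ φ → Derivable Γ (imp φ ψ) → Derivable Γ ψ

/-- The axiom `φ ∨ ¬(φ²)` (the schema is obtained by substitution). -/
def dpAxiom : MTLFormula := sup (var 0) (neg (conj (var 0) (var 0)))

/-- Axiomatic extensions of the logic DP (that is, of MTL plus `φ ∨ ¬(φ²)`), a logic being
given by its set of theorems. -/
def IsAxiomaticExtensionOfDP (L : Set MTLFormula) : Prop :=
  ∃ Γ : Set MTLFormula, L = {φ | Derivable ({dpAxiom} ∪ Γ) φ}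

end MTLFormula

namespace MTLAlg

/-- The class of the MTL-algebras that satisfy all equations `φ ≈ ψ` with `(φ, ψ) ∈ E`. -/
def models (E : Set (MTLFormula × MTLFormula)) : Set MTLAlg.{u} :=
  {A | ∀ e ∈ E, ∀ v : ℕ → A, e.1.eval v = e.2.eval v}

/-- A class of MTL-algebras is a variety if it is an equational class. -/
def IsVariety (V : Set MTLAlg.{u}) : Prop :=
  ∃ E : Set (MTLFormula × MTLFormula), V = models E

/-- The variety generated by a class of MTL-algebras: the smallest variety that contains it. -/
def generated (K : Set MTLAlg.{u}) : Set MTLAlg.{u} :=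
  ⋂₀ {V | IsVariety V ∧ K ⊆ V}

theorem isVariety_generated (K : Set MTLAlg.{u}) : IsVariety (generated K) := by
  refine ⟨{e | K ⊆ models {e}}, Set.Subset.antisymm ?_ ?_⟩
  · exact Set.sInter_subset_of_mem
      ⟨⟨_, rfl⟩, fun A hA e he v => he hA e rfl v⟩
  · rintro A hA V ⟨⟨E, rfl⟩, hK⟩ e he v
    refine hA e (fun B hB e' he' w => ?_) v
    rw [Set.mem_singleton_iff.1 he']
    exact hK hB e he w

/-- The variety `DP` of drastic product algebras, generated by all drastic product chains. -/
def DP : Set MTLAlg.{u} := generated {A | A.IsDPChain}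

end MTLAlg

/-! A formula refuted in an MTL-algebra `A` is refuted in a chain satisfying the same identities:
pass to the quotient by a prime filter avoiding the refuting value. This quotient is taken as the
Lindenbaum algebra of the theory of all formulas whose value lies in the filter, so one construction
serves both this reduction and the completeness theorem. In a chain `1` is join-prime, so the chains
validating `dpAxiom` are exactly the DP-chains.

A nontrivial DP-chain has a coatom `c`, and `x ⇨ y = c` whenever `y < x < 1` (`himp_eq_coatom`). All
operations are thus determined by the order, and any subset containing `⊥`, `c`, `1` is a
subalgebra. A refutation involves finitely many elements, so it transfers to every DP-chain with at
least that many elements (`IsDPChain.exists_finset`).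

A subvariety is therefore determined by the sizes of its DP-chains, which the formulas `noChain`
measure. If the sizes are unbounded it is `DP`; otherwise a largest chain generates it
(`subvariety_classification`). Chains of every finite size exist, so all these varieties differ.
Soundness and completeness carry the result over to logics. -/

/-! ### Theories and their Lindenbaum algebras -/

namespace MTLFormula

/-- Sets of formulas that contain the axioms of MTL and are closed under modus ponens. -/
structure IsTheory (T : Set MTLFormula) : Prop where
  ax {φ : MTLFormula} : IsMTLAxiom φ → φ ∈ T
  mp {φ ψ : MTLFormula} : φ ∈ T → imp φ ψ ∈ T → ψ ∈ T

namespace IsTheory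

variable {T : Set MTLFormula} {φ ψ χ θ : MTLFormula}

theorem le_trans (h : IsTheory T) (h₁ : imp φ ψ ∈ T) (h₂ : imp ψ χ ∈ T) : imp φ χ ∈ T :=
  h.mp h₂ (h.mp h₁ (h.ax (.trans φ ψ χ)))

theorem curry (h : IsTheory T) (h₁ : imp (conj φ ψ) χ ∈ T) : imp φ (imp ψ χ) ∈ T :=
  h.mp h₁ (h.ax (.curry φ ψ χ))

theorem uncurry (h : IsTheory T) (h₁ : imp φ (imp ψ χ) ∈ T) : imp (conj φ ψ) χ ∈ T :=
  h.mp h₁ (h.ax (.uncurry φ ψ χ))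

theorem weaken (h : IsTheory T) (h₁ : φ ∈ T) : imp ψ φ ∈ T :=
  h.mp h₁ (h.curry (h.ax (.conj_left φ ψ)))

theorem exchange (h : IsTheory T) (h₁ : imp φ (imp ψ χ) ∈ T) : imp ψ (imp φ χ) ∈ T :=
  h.curry (h.le_trans (h.ax (.conj_comm ψ φ)) (h.uncurry h₁))

/-- Exchange turns `φ → (⊤ → φ)` into `⊤ → (φ → φ)`, with the axiom `⊥ → ⊥` as `⊤`, which is then
detached. -/
theorem refl (h : IsTheory T) (φ : MTLFormula) : imp φ φ ∈ T :=
  h.mp (h.ax (.bot_imp bot)) (h.exchange (h.curry (h.ax (.conj_left φ (imp bot bot)))))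

theorem conj_mono_left (h : IsTheory T) (h₁ : imp φ ψ ∈ T) : imp (conj φ χ) (conj ψ χ) ∈ T :=
  h.uncurry (h.le_trans h₁ (h.curry (h.refl _)))

theorem conj_mono (h : IsTheory T) (h₁ : imp φ ψ ∈ T) (h₂ : imp χ θ ∈ T) :
    imp (conj φ χ) (conj ψ θ) ∈ T :=
  h.le_trans (h.conj_mono_left h₁) (h.le_trans (h.ax (.conj_comm _ _))
    (h.le_trans (h.conj_mono_left h₂) (h.ax (.conj_comm _ _))))

theorem imp_mono (h : IsTheory T) (h₁ : imp ψ φ ∈ T) (h₂ : imp χ θ ∈ T) :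
    imp (imp φ χ) (imp ψ θ) ∈ T :=
  h.curry (h.le_trans (h.conj_mono (h.refl _) h₁) (h.le_trans (h.uncurry (h.refl _)) h₂))

theorem inf_right (h : IsTheory T) : imp (inf φ ψ) ψ ∈ T :=
  h.le_trans (h.ax (.inf_comm _ _)) (h.ax (.inf_left _ _))

theorem cases (h : IsTheory T) (h₁ : imp (imp φ ψ) χ ∈ T) (h₂ : imp (imp ψ φ) χ ∈ T) : χ ∈ T :=
  h.mp h₂ (h.mp h₁ (h.ax (.prelin φ ψ χ)))

/-- Prelinearity splits into two cases: under `φ → ψ` the axiom `conj_imp` puts `φ` below `φ ∧ ψ`,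
and the other case is symmetric. -/
theorem le_inf (h : IsTheory T) (h₁ : imp χ φ ∈ T) (h₂ : imp χ ψ ∈ T) : imp χ (inf φ ψ) ∈ T := by
  have key : ∀ α β, imp (imp α β) (imp α (inf α β)) ∈ T := fun α β =>
    h.exchange (h.curry (h.ax (.conj_imp α β)))
  refine h.cases (φ := φ) (ψ := ψ) ?_ ?_
  · exact h.le_trans (key φ ψ) (h.imp_mono h₁ (h.refl _))
  · exact h.le_trans (key ψ φ) (h.imp_mono h₂ (h.ax (.inf_comm _ _)))

theorem inf_mono (h : IsTheory T) (h₁ : imp φ ψ ∈ T) (h₂ : imp χ θ ∈ T) :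
    imp (inf φ χ) (inf ψ θ) ∈ T :=
  h.le_inf (h.le_trans (h.ax (.inf_left _ _)) h₁) (h.le_trans h.inf_right h₂)

theorem conj_assoc_left (h : IsTheory T) :
    imp (conj (conj φ ψ) χ) (conj φ (conj ψ χ)) ∈ T :=
  h.uncurry (h.uncurry (h.le_trans (h.curry (h.refl _)) (h.ax (.curry _ _ _))))

theorem conj_assoc_right (h : IsTheory T) :
    imp (conj φ (conj ψ χ)) (conj (conj φ ψ) χ) ∈ T :=
  h.uncurry (h.le_trans (h.curry (h.curry (h.refl _))) (h.ax (.uncurry _ _ _)))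

theorem top_mem (h : IsTheory T) : top ∈ T := h.ax (.bot_imp bot)

theorem le_sup_left (h : IsTheory T) : imp φ (sup φ ψ) ∈ T :=
  h.le_inf (h.exchange (h.refl _)) (h.curry (h.ax (.conj_left _ _)))

theorem le_sup_right (h : IsTheory T) : imp ψ (sup φ ψ) ∈ T :=
  h.le_inf (h.curry (h.ax (.conj_left _ _))) (h.exchange (h.refl _))

/-- Again by prelinearity: `φ → ψ` reduces the first conjunct of the defined disjunction to `ψ`, and
`ψ → φ` reduces the second to `φ`. -/
theorem sup_le (h : IsTheory T) (h₁ : imp φ χ ∈ T) (h₂ : imp ψ χ ∈ T) : imp (sup φ ψ) χ ∈ T := by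
  refine h.cases (φ := φ) (ψ := ψ) (h.exchange ?_) (h.exchange ?_)
  · exact h.le_trans (h.ax (.inf_left _ _)) (h.imp_mono (h.refl _) h₂)
  · exact h.le_trans h.inf_right (h.imp_mono (h.refl _) h₁)

/-- Interderivability modulo a theory. -/
def setoid (h : IsTheory T) : Setoid (ULift.{u} MTLFormula) where
  r φ ψ := imp φ.down ψ.down ∈ T ∧ imp ψ.down φ.down ∈ T
  iseqv := ⟨fun _ => ⟨h.refl _, h.refl _⟩, And.symm,
    fun h₁ h₂ => ⟨h.le_trans h₁.1 h₂.1, h.le_trans h₂.2 h₁.2⟩⟩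

/-- The Lindenbaum algebra of a theory. -/
def Lindenbaum (h : IsTheory T) : Type u := Quotient (setoid.{u} h)

/-- The class of a formula in the Lindenbaum algebra. -/
def cls (h : IsTheory T) (φ : MTLFormula) : Lindenbaum.{u} h := Quotient.mk (setoid.{u} h) ⟨φ⟩

theorem cls_surjective (h : IsTheory T) : Function.Surjective (cls.{u} h) := by
  rintro ⟨φ⟩
  exact ⟨φ.down, rfl⟩

theorem cls_eq_cls (h : IsTheory T) :
    cls.{u} h φ = cls h ψ ↔ imp φ ψ ∈ T ∧ imp ψ φ ∈ T :=
  Quotient.eq (r := setoid.{u} h)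

/-- A binary connective as an operation on the Lindenbaum algebra. -/
def op (h : IsTheory T) (f : MTLFormula → MTLFormula → MTLFormula)
    (hf : ∀ φ φ' ψ ψ', imp φ φ' ∈ T → imp φ' φ ∈ T → imp ψ ψ' ∈ T → imp ψ' ψ ∈ T →
      imp (f φ ψ) (f φ' ψ') ∈ T) : Lindenbaum.{u} h → Lindenbaum.{u} h → Lindenbaum.{u} h :=
  Quotient.map₂ (fun φ ψ => ⟨f φ.down ψ.down⟩)
    (fun _ _ h₁ _ _ h₂ => ⟨hf _ _ _ _ h₁.1 h₁.2 h₂.1 h₂.2, hf _ _ _ _ h₁.2 h₁.1 h₂.2 h₂.1⟩)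

instance (h : IsTheory T) : LE (Lindenbaum.{u} h) where
  le := Quotient.lift₂ (fun φ ψ => imp φ.down ψ.down ∈ T)
    (fun _ _ _ _ h₁ h₂ => propext
      ⟨fun h₃ => h.le_trans h₁.2 (h.le_trans h₃ h₂.1),
        fun h₃ => h.le_trans h₁.1 (h.le_trans h₃ h₂.2)⟩)

instance (h : IsTheory T) : MTLAlgebra (Lindenbaum.{u} h) where
  le_refl := by rintro ⟨φ⟩; exact h.refl _
  le_trans := by rintro ⟨φ⟩ ⟨ψ⟩ ⟨χ⟩ h₁ h₂; exact h.le_trans h₁ h₂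
  le_antisymm := by rintro ⟨φ⟩ ⟨ψ⟩ h₁ h₂; exact h.cls_eq_cls.2 ⟨h₁, h₂⟩
  mul := h.op conj fun _ _ _ _ h₁ _ h₂ _ => h.conj_mono h₁ h₂
  inf := h.op inf fun _ _ _ _ h₁ _ h₂ _ => h.inf_mono h₁ h₂
  sup := h.op sup fun _ _ _ _ h₁ _ h₂ _ =>
    h.sup_le (h.le_trans h₁ h.le_sup_left) (h.le_trans h₂ h.le_sup_right)
  himp := h.op imp fun _ _ _ _ _ h₁ h₂ _ => h.imp_mono h₁ h₂
  one := h.cls top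
  top := h.cls top
  bot := h.cls bot
  mul_assoc := by
    rintro ⟨φ⟩ ⟨ψ⟩ ⟨χ⟩; exact h.cls_eq_cls.2 ⟨h.conj_assoc_left, h.conj_assoc_right⟩
  mul_comm := by
    rintro ⟨φ⟩ ⟨ψ⟩; exact h.cls_eq_cls.2 ⟨h.ax (.conj_comm _ _), h.ax (.conj_comm _ _)⟩
  one_mul := by
    rintro ⟨φ⟩
    exact h.cls_eq_cls.2 ⟨h.uncurry (h.weaken (h.refl _)), h.mp h.top_mem (h.curry (h.refl _))⟩
  mul_one := by
    rintro ⟨φ⟩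
    exact h.cls_eq_cls.2 ⟨h.ax (.conj_left _ _),
      h.mp h.top_mem (h.exchange (h.curry (h.refl _)))⟩
  inf_le_left := by rintro ⟨φ⟩ ⟨ψ⟩; exact h.ax (.inf_left _ _)
  inf_le_right := by rintro ⟨φ⟩ ⟨ψ⟩; exact h.inf_right
  le_inf := by rintro ⟨φ⟩ ⟨ψ⟩ ⟨χ⟩ h₁ h₂; exact h.le_inf h₁ h₂
  le_sup_left := by rintro ⟨φ⟩ ⟨ψ⟩; exact h.le_sup_left
  le_sup_right := by rintro ⟨φ⟩ ⟨ψ⟩; exact h.le_sup_right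
  sup_le := by rintro ⟨φ⟩ ⟨ψ⟩ ⟨χ⟩ h₁ h₂; exact h.sup_le h₁ h₂
  le_top := by rintro ⟨φ⟩; exact h.weaken h.top_mem
  bot_le := by rintro ⟨φ⟩; exact h.ax (.bot_imp _)
  mul_le_iff_le_himp := by rintro ⟨φ⟩ ⟨ψ⟩ ⟨χ⟩; exact ⟨h.curry, h.uncurry⟩
  one_eq_top := rfl
  prelinear := by
    rintro ⟨φ⟩ ⟨ψ⟩
    exact h.cls_eq_cls.2 ⟨h.weaken h.top_mem,
      h.weaken (h.cases h.le_sup_left h.le_sup_right)⟩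

theorem cls_eq_one (h : IsTheory T) : cls.{u} h φ = 1 ↔ φ ∈ T :=
  h.cls_eq_cls.trans ⟨fun h₁ => h.mp h.top_mem h₁.2, fun h₁ => ⟨h.weaken h.top_mem, h.weaken h₁⟩⟩

/-- As `cls` is surjective, every valuation in the Lindenbaum algebra comes from a substitution;
validity there means that all substitution instances lie in `T`. -/
theorem eval_cls (h : IsTheory T) (σ : ℕ → MTLFormula) (φ : MTLFormula) :
    eval (fun n => cls.{u} h (σ n)) φ = h.cls (subst σ φ) := by
  induction φ with
  | var n => rfl
  | bot => rfl
  | conj φ ψ ih₁ ih₂ => simp only [eval, subst, ih₁, ih₂]; rfl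
  | inf φ ψ ih₁ ih₂ => simp only [eval, subst, ih₁, ih₂]; rfl
  | imp φ ψ ih₁ ih₂ => simp only [eval, subst, ih₁, ih₂]; rfl

end IsTheory

theorem subst_var (φ : MTLFormula) : subst var φ = φ := by
  induction φ with
  | var n => rfl
  | bot => rfl
  | conj φ ψ ih₁ ih₂ => simp only [subst, ih₁, ih₂]
  | inf φ ψ ih₁ ih₂ => simp only [subst, ih₁, ih₂]
  | imp φ ψ ih₁ ih₂ => simp only [subst, ih₁, ih₂]

end MTLFormula

/-! ### Arithmetic of MTL-algebras, soundness and prime filters -/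

namespace MTLAlgebra

variable {A : Type*} [MTLAlgebra A]

theorem le_one (x : A) : x ≤ 1 := one_eq_top (A := A) ▸ le_top

theorem himp_mul_le (x y : A) : (x ⇨ y) * x ≤ y := (mul_le_iff_le_himp _ _ _).2 le_rfl

instance : IsOrderedMonoid A where
  mul_le_mul_left _ _ h c :=
    (mul_le_iff_le_himp _ _ _).2 (h.trans ((mul_le_iff_le_himp _ _ _).1 (le_refl (_ * c))))

theorem mul_le_left (x y : A) : x * y ≤ x := mul_le_of_le_one_right' (le_one y)

theorem mul_le_right (x y : A) : x * y ≤ y := mul_le_of_le_one_left' (le_one x)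

theorem himp_eq_one {x y : A} : x ⇨ y = 1 ↔ x ≤ y := by
  rw [← one_mul x, mul_le_iff_le_himp, one_mul]
  exact ⟨fun h => h.ge, fun h => le_antisymm (le_one _) h⟩

/-- Both `x` and `y` lie below `x ^ n ⇨ (x ^ (n + 1) ⊔ y)`, which is therefore `1`; so `x ^ n ≤ x ^
(n + 1) ⊔ y`. -/
theorem pow_sup_eq_one {x y : A} (h : x ⊔ y = 1) (n : ℕ) : x ^ n ⊔ y = 1 := by
  induction n with
  | zero => simpa using le_one y
  | succ n ih =>
    refine le_antisymm (le_one _) ?_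
    have hle : x ⊔ y ≤ x ^ n ⇨ (x ^ (n + 1) ⊔ y) := by
      refine sup_le ?_ ?_ <;> rw [← mul_le_iff_le_himp]
      · rw [pow_succ']; exact le_sup_left
      · exact (mul_le_left _ _).trans le_sup_right
    rw [h, ← mul_le_iff_le_himp, one_mul] at hle
    rw [← ih]
    exact sup_le hle le_sup_right

theorem pow_sup_pow_eq_one {x y : A} (h : x ⊔ y = 1) (m n : ℕ) : x ^ m ⊔ y ^ n = 1 := by
  rw [sup_comm]
  exact pow_sup_eq_one (by rw [sup_comm]; exact pow_sup_eq_one h m) n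

/-- Filters of an MTL-algebra. -/
structure IsFilter (F : Set A) : Prop where
  one_mem : 1 ∈ F
  mul_mem {x y : A} : x ∈ F → y ∈ F → x * y ∈ F
  mem_of_le {x y : A} : x ∈ F → x ≤ y → y ∈ F

/-- The filter generated by a filter and an element. -/
theorem IsFilter.adjoin {F : Set A} (hF : IsFilter F) (a : A) :
    IsFilter {x | ∃ f ∈ F, ∃ n : ℕ, f * a ^ n ≤ x} where
  one_mem := ⟨1, hF.one_mem, 0, by simp⟩
  mul_mem := by
    rintro x y ⟨f, hf, m, hx⟩ ⟨g, hg, n, hy⟩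
    refine ⟨f * g, hF.mul_mem hf hg, m + n, ?_⟩
    rw [pow_add, mul_mul_mul_comm]
    exact mul_le_mul' hx hy
  mem_of_le := by
    rintro x y ⟨f, hf, m, hx⟩ hxy
    exact ⟨f, hf, m, hx.trans hxy⟩

/-- Every element other than `1` is avoided by a prime filter. -/
theorem exists_prime_filter {a : A} (ha : a ≠ 1) :
    ∃ F : Set A, IsFilter F ∧ a ∉ F ∧ ∀ x y : A, x ⇨ y ∈ F ∨ y ⇨ x ∈ F := by
  -- A filter maximal among those avoiding `a` is prime.
  obtain ⟨F, -, hF⟩ := zorn_subset_nonempty {F : Set A | IsFilter F ∧ a ∉ F} (by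
    intro c hc hch hne
    refine ⟨⋃₀ c, ⟨⟨?_, ?_, ?_⟩, ?_⟩, fun s hs => Set.subset_sUnion_of_mem hs⟩
    · obtain ⟨s, hs⟩ := hne
      exact ⟨s, hs, (hc hs).1.one_mem⟩
    · rintro x y ⟨s, hs, hx⟩ ⟨t, ht, hy⟩
      rcases hch.total hs ht with hst | hst
      · exact ⟨t, ht, (hc ht).1.mul_mem (hst hx) hy⟩
      · exact ⟨s, hs, (hc hs).1.mul_mem hx (hst hy)⟩
    · rintro x y ⟨s, hs, hx⟩ hxy
      exact ⟨s, hs, (hc hs).1.mem_of_le hx hxy⟩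
    · rintro ⟨s, hs, has⟩
      exact (hc hs).2 has) {1}
    ⟨⟨rfl, by rintro _ _ rfl rfl; exact one_mul 1,
      by rintro _ y rfl h; exact le_antisymm (le_one y) h⟩, ha⟩
  have key : ∀ b ∉ F, ∃ f ∈ F, ∃ n : ℕ, f * b ^ n ≤ a := by
    intro b hb
    by_contra hcon
    refine hb (hF.2 ⟨hF.1.1.adjoin b, hcon⟩ ?_ ⟨1, hF.1.1.one_mem, 1, by simp⟩)
    exact fun f hf => ⟨f, hf, 0, by simp⟩
  refine ⟨F, hF.1.1, hF.1.2, fun x y => ?_⟩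
  by_contra! hxy
  obtain ⟨f, hf, m, hm⟩ := key _ hxy.1
  obtain ⟨g, hg, n, hn⟩ := key _ hxy.2
  refine hF.1.2 (hF.1.1.mem_of_le (hF.1.1.mul_mem hf hg) ?_)
  -- By prelinearity the left side is `1`, which forces `f * g ≤ a` and so `a ∈ F`.
  have hle : (x ⇨ y) ^ m ⊔ (y ⇨ x) ^ n ≤ (f * g) ⇨ a := by
    refine sup_le ?_ ?_ <;> rw [← mul_le_iff_le_himp, mul_comm]
    · exact (mul_le_mul_left (mul_le_left _ _) _).trans hm
    · exact (mul_le_mul_left (mul_le_right _ _) _).trans hn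
  rwa [pow_sup_pow_eq_one (prelinear x y), ← mul_le_iff_le_himp, one_mul] at hle

theorem eval_subst (v : ℕ → A) (σ : ℕ → MTLFormula) (φ : MTLFormula) :
    (φ.subst σ).eval v = φ.eval fun n => (σ n).eval v := by
  induction φ with
  | var n => rfl
  | bot => rfl
  | conj φ ψ ih₁ ih₂ => simp only [MTLFormula.eval, MTLFormula.subst, ih₁, ih₂]
  | inf φ ψ ih₁ ih₂ => simp only [MTLFormula.eval, MTLFormula.subst, ih₁, ih₂]
  | imp φ ψ ih₁ ih₂ => simp only [MTLFormula.eval, MTLFormula.subst, ih₁, ih₂]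

/-- The axioms of MTL are valid in all MTL-algebras. -/
theorem eval_axiom (v : ℕ → A) {φ : MTLFormula} (h : MTLFormula.IsMTLAxiom φ) :
    φ.eval v = 1 := by
  have res := @mul_le_iff_le_himp A _
  cases h <;> simp only [MTLFormula.eval, himp_eq_one]
  case trans φ ψ χ =>
    rw [← res, ← res, mul_right_comm]
    exact (mul_le_mul_left (himp_mul_le _ _) _).trans ((mul_comm _ _).trans_le (himp_mul_le _ _))
  case conj_left => exact mul_le_left _ _
  case conj_comm => rw [mul_comm]
  case inf_left => exact inf_le_left
  case inf_comm => rw [inf_comm]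
  case conj_imp => exact le_inf (mul_le_left _ _) ((mul_comm _ _).trans_le (himp_mul_le _ _))
  case uncurry => rw [← res, ← mul_assoc, res, res]
  case curry => rw [← res, ← res, mul_assoc, res]
  case prelin φ ψ χ =>
    generalize φ.eval v = x
    generalize ψ.eval v = y
    generalize χ.eval v = z
    rw [← res]
    have hle : (x ⇨ y) ⊔ (y ⇨ x) ≤ (((x ⇨ y) ⇨ z) * ((y ⇨ x) ⇨ z)) ⇨ z := by
      refine sup_le ?_ ?_ <;> rw [← res, mul_comm]
      · exact (mul_le_mul_left (mul_le_left _ _) _).trans (himp_mul_le _ _)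
      · exact (mul_le_mul_left (mul_le_right _ _) _).trans (himp_mul_le _ _)
    rwa [prelinear, ← res, one_mul] at hle
  case bot_imp => exact bot_le

theorem IsFilter.isTheory {F : Set A} (hF : IsFilter F) (v : ℕ → A) :
    MTLFormula.IsTheory {φ | φ.eval v ∈ F} where
  ax h := by
    rw [Set.mem_ofPred_eq, eval_axiom v h]
    exact hF.one_mem
  mp h₁ h₂ := hF.mem_of_le (hF.mul_mem h₂ h₁) (himp_mul_le _ _)

end MTLAlgebra

namespace MTLFormula

/-- The formula that has the value `1` if and only if the two formulas have the same value. -/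
def equ (φ ψ : MTLFormula) : MTLFormula := inf (imp φ ψ) (imp ψ φ)

theorem eval_equ {A : Type*} [MTLAlgebra A] (v : ℕ → A) (φ ψ : MTLFormula) :
    eval v (equ φ ψ) = 1 ↔ eval v φ = eval v ψ := by
  have key : ∀ x y : A, (x ⇨ y) ⊓ (y ⇨ x) = 1 ↔ x = y := fun x y => by
    rw [MTLAlgebra.one_eq_top, inf_eq_top_iff, ← MTLAlgebra.one_eq_top, MTLAlgebra.himp_eq_one,
      MTLAlgebra.himp_eq_one]
    exact antisymm_iff
  exact key _ _

theorem eval_equ_top {A : Type*} [MTLAlgebra A] (v : ℕ → A) (φ : MTLFormula) :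
    eval v (equ φ top) = 1 ↔ eval v φ = 1 := by
  rw [eval_equ, eval_top]

end MTLFormula

namespace MTLAlg

open MTLFormula

/-- A formula is valid in an algebra if it has the value `1` under all valuations. -/
def Valid (A : MTLAlg.{u}) (φ : MTLFormula) : Prop := ∀ v : ℕ → A, φ.eval v = 1

theorem mem_models {A : MTLAlg.{u}} {E : Set (MTLFormula × MTLFormula)} :
    A ∈ models E ↔ ∀ e ∈ E, A.Valid (equ e.1 e.2) :=
  forall₂_congr fun _ _ => forall_congr' fun _ => (eval_equ _ _ _).symm

/-- The algebras in which all members of a set of formulas are valid. -/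
def modelsOf (L : Set MTLFormula) : Set MTLAlg.{u} := {A | ∀ φ ∈ L, A.Valid φ}

theorem modelsOf_eq_models (L : Set MTLFormula) :
    modelsOf.{u} L = models ((fun φ => (φ, top)) '' L) := by
  ext A
  rw [mem_models, Set.forall_mem_image]
  exact forall₂_congr fun φ _ => forall_congr' fun v => (eval_equ_top v φ).symm

theorem models_eq_modelsOf (E : Set (MTLFormula × MTLFormula)) :
    models.{u} E = modelsOf ((fun e => equ e.1 e.2) '' E) := by
  ext A
  rw [mem_models]
  exact (Set.forall_mem_image (p := fun φ => A.Valid φ)).symm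

theorem isVariety_iff {V : Set MTLAlg.{u}} : IsVariety V ↔ ∃ L, V = modelsOf L :=
  ⟨fun ⟨E, h⟩ => ⟨_, h.trans (models_eq_modelsOf E)⟩,
    fun ⟨L, h⟩ => ⟨_, h.trans (modelsOf_eq_models L)⟩⟩

/-- Every formula that is not valid in a member of a variety is not valid in a chain of the
variety. -/
theorem exists_chain_not_valid {L : Set MTLFormula} {A : MTLAlg.{u}} (hA : A ∈ modelsOf L)
    {φ : MTLFormula} (hφ : ¬ A.Valid φ) :
    ∃ B : MTLAlg.{u}, B ∈ modelsOf L ∧ (∀ x y : B, x ≤ y ∨ y ≤ x) ∧ ¬ B.Valid φ := by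
  obtain ⟨v, hv⟩ := not_forall.1 hφ
  obtain ⟨F, hF, hvF, hprime⟩ := MTLAlgebra.exists_prime_filter hv
  have hT := hF.isTheory v
  -- This algebra is the quotient by `F` of the subalgebra generated by the values of `v`; primeness
  -- of `F` is totality of its order.
  refine ⟨⟨hT.Lindenbaum⟩, ?_, ?_, ?_⟩
  · intro ψ hψ w
    choose σ hσ using fun n => hT.cls_surjective (w n)
    obtain rfl : (fun n => hT.cls (σ n)) = w := funext hσ
    refine (hT.eval_cls σ ψ).trans (hT.cls_eq_one.2 ?_)
    rw [Set.mem_ofPred_eq, MTLAlgebra.eval_subst, hA ψ hψ]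
    exact hF.one_mem
  · intro x y
    obtain ⟨α, rfl⟩ := hT.cls_surjective x
    obtain ⟨β, rfl⟩ := hT.cls_surjective y
    exact hprime _ _
  · intro hB
    have h := (hT.eval_cls var φ).symm.trans (hB _)
    rw [subst_var, hT.cls_eq_one] at h
    exact hvF h

end MTLAlg

/-! ### Drastic product chains -/

namespace MTLAlg

open MTLFormula

theorem sup_eq_one_of_total {A : MTLAlg.{u}} (hA : ∀ x y : A, x ≤ y ∨ y ≤ x) {x y : A}
    (h : x ⊔ y = 1) : x = 1 ∨ y = 1 := by
  rcases hA x y with hxy | hxy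
  · exact Or.inr (by rwa [sup_eq_right.2 hxy] at h)
  · exact Or.inl (by rwa [sup_eq_left.2 hxy] at h)

theorem eval_dpAxiom {A : MTLAlg.{u}} (v : ℕ → A) :
    dpAxiom.eval v = v 0 ⊔ (v 0 * v 0 ⇨ ⊥) := eval_sup _ _ _

theorem IsDPChain.valid_dpAxiom {A : MTLAlg.{u}} (hA : A.IsDPChain) : A.Valid dpAxiom := by
  intro v
  rw [eval_dpAxiom]
  refine le_antisymm (MTLAlgebra.le_one _) ?_
  rcases (MTLAlgebra.le_one (v 0)).eq_or_lt with h | h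
  · exact h.ge.trans le_sup_left
  · rw [hA.2.1 _ _ ⟨h, h⟩, MTLAlgebra.himp_eq_one.2 le_rfl]
    exact le_sup_right

/-- Join-primeness of `1` turns the axiom into `x = 1` or `x * x = ⊥`, and a product of two elements
below `1` lies below the square of the larger. -/
theorem isDPChain_of_valid {A : MTLAlg.{u}} (hA : ∀ x y : A, x ≤ y ∨ y ≤ x)
    (h : A.Valid dpAxiom) : A.IsDPChain := by
  have hsq : ∀ x : A, x < 1 → x * x = ⊥ := by
    intro x hx
    have := h fun _ => x
    rw [eval_dpAxiom] at this
    rcases sup_eq_one_of_total hA this with h1 | h1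
    · exact absurd h1 hx.ne
    · exact le_bot_iff.1 (MTLAlgebra.himp_eq_one.1 h1)
  refine ⟨hA, ?_, ?_⟩
  · rintro x y ⟨hx, hy⟩
    rw [← le_bot_iff]
    rcases hA x y with hxy | hxy
    · exact (mul_le_mul' hxy le_rfl).trans (hsq y hy).le
    · exact (mul_le_mul' le_rfl hxy).trans (hsq x hx).le
  · intro x y hxy
    rcases (MTLAlgebra.le_one x).eq_or_lt with rfl | hx
    · rw [one_mul, inf_eq_right.2 (MTLAlgebra.le_one y)]
    · rcases (MTLAlgebra.le_one y).eq_or_lt with rfl | hy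
      · rw [mul_one, inf_eq_left.2 (MTLAlgebra.le_one x)]
      · exact absurd ⟨hx, hy⟩ hxy

namespace IsDPChain

variable {A : MTLAlg.{u}}

/-- The linear order of a drastic product chain. -/
@[reducible]
noncomputable def linearOrder (hA : A.IsDPChain) : LinearOrder A :=
  haveI : Std.Total (fun x y : A => x ≤ y) := ⟨hA.1⟩
  letI := Classical.decEq A
  letI := Classical.decRel (α := A) (· ≤ ·)
  letI := Classical.decRel (α := A) (· < ·)
  Lattice.toLinearOrder A

theorem not_le (hA : A.IsDPChain) {x y : A} : ¬ x ≤ y ↔ y < x :=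
  ⟨fun h => lt_of_le_not_ge ((hA.1 x y).resolve_left h) h, fun h => h.not_ge⟩

/-- In a nontrivial drastic product chain there is a largest element below `1`. -/
theorem exists_coatom (hA : A.IsDPChain) (h : (⊥ : A) < 1) :
    ∃ c : A, c < 1 ∧ ∀ z : A, z < 1 → z ≤ c := by
  by_cases hx : ∃ x : A, ⊥ < x ∧ x < 1
  · obtain ⟨x, hx0, hx1⟩ := hx
    -- Everything below `1` annihilates `x`, so lies below its negation, which is not `1` because `x
    -- ≠ ⊥`.
    refine ⟨x ⇨ ⊥, lt_of_le_of_ne (MTLAlgebra.le_one _) ?_, fun z hz => ?_⟩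
    · rw [Ne, MTLAlgebra.himp_eq_one, hA.not_le]
      exact hx0
    · rw [← MTLAlgebra.mul_le_iff_le_himp, hA.2.1 _ _ ⟨hz, hx1⟩]
  · push Not at hx
    refine ⟨⊥, h, fun z hz => ?_⟩
    by_contra hz0
    exact (hx z (hA.not_le.1 hz0)) hz

/-- The product `c * x = ⊥` is below `y`, so `c ≤ x ⇨ y`; and the residuum is not `1` because `x ≰
y`. -/
theorem himp_eq_coatom (hA : A.IsDPChain) {c : A} (hc : c < 1) (hc' : ∀ z : A, z < 1 → z ≤ c)
    {x y : A} (hyx : y < x) (hx : x < 1) : x ⇨ y = c := by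
  refine le_antisymm (hc' _ (lt_of_le_of_ne (MTLAlgebra.le_one _) ?_)) ?_
  · rw [Ne, MTLAlgebra.himp_eq_one]
    exact hyx.not_ge
  · rw [← MTLAlgebra.mul_le_iff_le_himp, hA.2.1 _ _ ⟨hc, hx⟩]
    exact bot_le

end IsDPChain

theorem one_himp {A : MTLAlg.{u}} (y : A) : (1 : A) ⇨ y = y :=
  le_antisymm (by simpa using MTLAlgebra.himp_mul_le (1 : A) y)
    ((MTLAlgebra.mul_le_iff_le_himp _ _ _).1 (mul_one y).le)

/-- A map that preserves the operations on a subset closed under them preserves the values of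
formulas. -/
theorem eval_comp {A B : MTLAlg.{u}} {S : Set A} {f : A → B} (hbot : ⊥ ∈ S) (fbot : f ⊥ = ⊥)
    (hmul : ∀ x ∈ S, ∀ y ∈ S, x * y ∈ S ∧ f (x * y) = f x * f y)
    (hinf : ∀ x ∈ S, ∀ y ∈ S, x ⊓ y ∈ S ∧ f (x ⊓ y) = f x ⊓ f y)
    (himp : ∀ x ∈ S, ∀ y ∈ S, (x ⇨ y) ∈ S ∧ f (x ⇨ y) = f x ⇨ f y)
    {v : ℕ → A} (hv : ∀ n, v n ∈ S) (φ : MTLFormula) :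
    φ.eval v ∈ S ∧ f (φ.eval v) = φ.eval (f ∘ v) := by
  induction φ with
  | var n => exact ⟨hv n, rfl⟩
  | bot => exact ⟨hbot, fbot⟩
  | conj φ ψ h₁ h₂ =>
    have := hmul _ h₁.1 _ h₂.1
    exact ⟨this.1, by rw [MTLFormula.eval, this.2, h₁.2, h₂.2]; rfl⟩
  | inf φ ψ h₁ h₂ =>
    have := hinf _ h₁.1 _ h₂.1
    exact ⟨this.1, by rw [MTLFormula.eval, this.2, h₁.2, h₂.2]; rfl⟩
  | imp φ ψ h₁ h₂ =>
    have := himp _ h₁.1 _ h₂.1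
    exact ⟨this.1, by rw [MTLFormula.eval, this.2, h₁.2, h₂.2]; rfl⟩

/-- For drastic product chains, strictly monotone maps that preserve the bounds and, where it
matters, the coatom preserve the values of formulas. -/
theorem IsDPChain.eval_comp {A B : MTLAlg.{u}} (hA : A.IsDPChain) (hB : B.IsDPChain)
    {S : Set A} {f : A → B} {c : A} {d : B} (hc : c < 1) (hc' : ∀ z : A, z < 1 → z ≤ c)
    (hd : d < 1) (hd' : ∀ z : B, z < 1 → z ≤ d)
    (hf : StrictMonoOn f S) (hbot : ⊥ ∈ S) (hone : 1 ∈ S) (hcS : c ∈ S)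
    (fbot : f ⊥ = ⊥) (fone : f 1 = 1) (fc : ⊥ < c → f c = d)
    {v : ℕ → A} (hv : ∀ n, v n ∈ S) (φ : MTLFormula) :
    φ.eval v ∈ S ∧ f (φ.eval v) = φ.eval (f ∘ v) := by
  have hlt : ∀ x ∈ S, x < 1 → f x < 1 := fun x hx h => fone ▸ hf hx hone h
  refine MTLAlg.eval_comp hbot fbot ?_ ?_ ?_ hv φ
  · intro x hx y hy
    rcases (MTLAlgebra.le_one x).eq_or_lt with rfl | hx1
    · simp [hy, fone]
    rcases (MTLAlgebra.le_one y).eq_or_lt with rfl | hy1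
    · simp [hx, fone]
    rw [hA.2.1 _ _ ⟨hx1, hy1⟩, hB.2.1 _ _ ⟨hlt x hx hx1, hlt y hy hy1⟩]
    exact ⟨hbot, fbot⟩
  · intro x hx y hy
    rcases hA.1 x y with h | h
    · rw [inf_eq_left.2 h, inf_eq_left.2 (hf.monotoneOn hx hy h)]
      exact ⟨hx, rfl⟩
    · rw [inf_eq_right.2 h, inf_eq_right.2 (hf.monotoneOn hy hx h)]
      exact ⟨hy, rfl⟩
  · intro x hx y hy
    by_cases hxy : x ≤ y
    · rw [MTLAlgebra.himp_eq_one.2 hxy, MTLAlgebra.himp_eq_one.2 (hf.monotoneOn hx hy hxy)]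
      exact ⟨hone, fone⟩
    rw [hA.not_le] at hxy
    rcases (MTLAlgebra.le_one x).eq_or_lt with rfl | hx1
    · rw [fone, one_himp, one_himp]
      exact ⟨hy, rfl⟩
    rw [hA.himp_eq_coatom hc hc' hxy hx1, hB.himp_eq_coatom hd hd' (hf hy hx hxy) (hlt x hx hx1)]
    -- The coatom arises as a value only when `⊥ ≤ y < x ≤ c`, so `fc` is needed only for `⊥ < c`.
    exact ⟨hcS, fc ((bot_le.trans_lt hxy).trans_le (hc' x hx1))⟩

/-- Between finite sets of equal size in linear orders there is an order isomorphism. -/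
theorem exists_strictMonoOn {α β : Type*} [Nonempty β] [LinearOrder α] [LinearOrder β]
    {S : Finset α} {T : Finset β} (h : S.card = T.card) :
    ∃ f : α → β, Set.BijOn f S T ∧ StrictMonoOn f S := by
  let e : S ≃o T := (S.orderIsoOfFin rfl).symm.trans (T.orderIsoOfFin h.symm)
  let f : α → β := fun x => if h : x ∈ S then e ⟨x, h⟩ else Classical.arbitrary β
  have hf : ∀ x (hx : x ∈ S), f x = e ⟨x, hx⟩ := fun x hx => dif_pos hx
  have hmono : StrictMonoOn f S := by
    intro x hx y hy hxy
    rw [hf x hx, hf y hy]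
    exact e.strictMono (a := ⟨x, hx⟩) (b := ⟨y, hy⟩) hxy
  refine ⟨f, ⟨fun x hx => ?_, hmono.injOn, fun y hy => ?_⟩, hmono⟩
  · rw [hf x hx]
    exact (e ⟨x, hx⟩).2
  · refine ⟨e.symm ⟨y, hy⟩, (e.symm ⟨y, hy⟩).2, ?_⟩
    rw [hf _ (e.symm ⟨y, hy⟩).2]
    simp

theorem exists_eval_congr {A : MTLAlg.{u}} (φ : MTLFormula) :
    ∃ N, ∀ v w : ℕ → A, (∀ n < N, v n = w n) → φ.eval v = φ.eval w := by
  have key : ∀ {φ ψ : MTLFormula} {op : A → A → A},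
      (∃ N, ∀ v w : ℕ → A, (∀ n < N, v n = w n) → φ.eval v = φ.eval w) →
      (∃ N, ∀ v w : ℕ → A, (∀ n < N, v n = w n) → ψ.eval v = ψ.eval w) →
      ∃ N, ∀ v w : ℕ → A, (∀ n < N, v n = w n) →
        op (φ.eval v) (ψ.eval v) = op (φ.eval w) (ψ.eval w) := by
    rintro φ ψ op ⟨M, hM⟩ ⟨N, hN⟩
    refine ⟨max M N, fun v w h => ?_⟩
    rw [hM v w fun n hn => h n (lt_max_of_lt_left hn),
      hN v w fun n hn => h n (lt_max_of_lt_right hn)]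
  induction φ with
  | var n => exact ⟨n + 1, fun v w h => h n n.lt_succ_self⟩
  | bot => exact ⟨0, fun v w h => rfl⟩
  | conj φ ψ h₁ h₂ => exact key h₁ h₂
  | inf φ ψ h₁ h₂ => exact key h₁ h₂
  | imp φ ψ h₁ h₂ => exact key h₁ h₂

/-- A formula that is not valid in a drastic product chain is not valid in any drastic product
chain with sufficiently many elements; the size of a finite part of the first one suffices. -/
theorem IsDPChain.exists_finset {A : MTLAlg.{u}} (hA : A.IsDPChain) {φ : MTLFormula}
    (hφ : ¬ A.Valid φ) :
    ∃ S : Finset A, ∀ B : MTLAlg.{u}, B.IsDPChain → ∀ T : Finset B, T.card = S.card →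
      ¬ B.Valid φ := by
  classical
  obtain ⟨v, hv⟩ := not_forall.1 hφ
  have h01 : (⊥ : A) < 1 := by
    refine lt_of_le_of_ne bot_le fun h => hv ?_
    exact le_antisymm (MTLAlgebra.le_one _) (h.ge.trans bot_le)
  obtain ⟨c, hc, hc'⟩ := hA.exists_coatom h01
  obtain ⟨N, hN⟩ := exists_eval_congr (A := A) φ
  let w : ℕ → A := fun n => if n < N then v n else ⊥
  have hw : φ.eval w ≠ 1 := by
    rwa [hN w v fun n hn => if_pos hn]
  let S : Finset A := {⊥, c, 1} ∪ (Finset.range N).image v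
  have hbot : ⊥ ∈ S := by simp [S]
  have hcS : c ∈ S := by simp [S]
  have hone : 1 ∈ S := by simp [S]
  have hwS : ∀ n, w n ∈ S := by
    intro n
    by_cases hn : n < N
    · simp only [w, if_pos hn, S, Finset.mem_union, Finset.mem_image, Finset.mem_range]
      exact Or.inr ⟨n, hn, rfl⟩
    · simp only [w, if_neg hn, hbot]
  refine ⟨S, fun B hB T hT hval => ?_⟩
  have h01' : (⊥ : B) < 1 := by
    refine lt_of_le_of_ne bot_le fun h => ?_
    have hsub : Subsingleton B := ⟨fun x y => by
      rw [le_antisymm (MTLAlgebra.le_one x) (h.ge.trans bot_le),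
        le_antisymm (MTLAlgebra.le_one y) (h.ge.trans bot_le)]⟩
    have h1 : T.card ≤ 1 := Finset.card_le_one_of_subsingleton T
    have h2 : 1 < S.card := Finset.one_lt_card.2 ⟨⊥, hbot, 1, hone, h01.ne⟩
    omega
  obtain ⟨d, hd, hd'⟩ := hB.exists_coatom h01'
  obtain ⟨f, hf, fbot, fone, fc⟩ : ∃ f : A → B, StrictMonoOn f S ∧ f ⊥ = ⊥ ∧ f 1 = 1 ∧
      (⊥ < c → f c = d) := by
    rcases (bot_le (a := c)).eq_or_lt with h | h
    · refine ⟨fun x => if x = 1 then 1 else ⊥, ?_, if_neg h01.ne, if_pos rfl,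
        fun h' => absurd h h'.ne⟩
      intro x _ y _ hxy
      have hx : x < 1 := hxy.trans_le (MTLAlgebra.le_one y)
      have hy : y = 1 := by
        by_contra hy
        have := hc' y (lt_of_le_of_ne (MTLAlgebra.le_one y) hy)
        rw [← h] at this
        exact not_lt_bot (hxy.trans_le this)
      simp only [if_neg hx.ne, if_pos hy, h01']
    · let := hA.linearOrder
      let := hB.linearOrder
      have h3 : 3 ≤ S.card := by
        have : ({⊥, c, 1} : Finset A).card = 3 := by
          rw [Finset.card_eq_three]
          exact ⟨_, _, _, h.ne, h01.ne, hc.ne, rfl⟩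
        rw [← this]
        exact Finset.card_le_card Finset.subset_union_left
      -- `T` may miss `⊥`, `d` or `1`; since `S` has at least three elements, a set `U` of the same
      -- size can be chosen to contain them.
      obtain ⟨U, hU, -, hUc⟩ := Finset.exists_subsuperset_card_eq
        (s := ({⊥, d, 1} : Finset B)) (t := {⊥, d, 1} ∪ T) (n := S.card)
        Finset.subset_union_left (Finset.card_le_three.trans h3)
        (hT ▸ Finset.card_le_card Finset.subset_union_right)
      have : Nonempty B := ⟨⊥⟩
      obtain ⟨f, hbij, hf⟩ := exists_strictMonoOn hUc.symm
      have hle : ∀ x ∈ S, ∀ y ∈ S, x ≤ y → f x ≤ f y := fun x hx y hy =>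
        hf.monotoneOn hx hy
      have hone' : f 1 = 1 := by
        obtain ⟨x, hx, hfx⟩ := hbij.surjOn (hU (by simp : (1 : B) ∈ _))
        exact le_antisymm (MTLAlgebra.le_one _)
          (hfx.ge.trans (hle x hx 1 hone (MTLAlgebra.le_one x)))
      refine ⟨f, hf, ?_, hone', fun _ => le_antisymm (hd' _ (hone' ▸ hf hcS hone hc)) ?_⟩
      · obtain ⟨x, hx, hfx⟩ := hbij.surjOn (hU (by simp : (⊥ : B) ∈ _))
        exact le_bot_iff.1 ((hle ⊥ hbot x hx bot_le).trans hfx.le)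
      · obtain ⟨x, hx, hfx⟩ := hbij.surjOn (hU (by simp : d ∈ _))
        refine hfx.ge.trans (hle x hx c hcS (hc' x (lt_of_le_of_ne (MTLAlgebra.le_one x) ?_)))
        rintro rfl
        exact hd.ne (hfx.symm.trans hone')
  obtain ⟨hS, heq⟩ := hA.eval_comp hB (S := S) hc hc' hd hd' hf hbot hone hcS fbot fone fc hwS φ
  rw [hval, ← fone] at heq
  let := hA.linearOrder
  exact hw (hf.injOn hS hone heq)

/-! ### The formulas that bound the size of a chain -/

/-- The formula stating that `x₀ < x₁ < ⋯ < xₙ` fails. -/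
def noChain : ℕ → MTLFormula
  | 0 => bot
  | n + 1 => sup (noChain n) (imp (var (n + 1)) (var n))

theorem eval_noChain_succ {A : MTLAlg.{u}} (v : ℕ → A) (n : ℕ) :
    (noChain (n + 1)).eval v = (noChain n).eval v ⊔ (v (n + 1) ⇨ v n) := eval_sup _ _ _

theorem Valid.noChain_mono {A : MTLAlg.{u}} {m n : ℕ} (hmn : m ≤ n) (h : A.Valid (noChain m)) :
    A.Valid (noChain n) := by
  induction n, hmn using Nat.le_induction with
  | base => exact h
  | succ n _ ih =>
    intro v
    rw [eval_noChain_succ, ih v]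
    exact sup_eq_left.2 (MTLAlgebra.le_one _)

/-- Join-primeness of `1` lets the disjuncts be read one by one; `⊥ ≠ 1` disposes of the initial
disjunct `bot`. -/
theorem IsDPChain.eval_noChain {A : MTLAlg.{u}} (hA : A.IsDPChain) (h01 : (⊥ : A) ≠ 1) (v : ℕ → A)
    (n : ℕ) : (noChain n).eval v ≠ 1 ↔ ∀ i < n, v i < v (i + 1) := by
  induction n with
  | zero => exact iff_of_true h01 fun i hi => absurd hi i.not_lt_zero
  | succ n ih =>
    rw [Nat.forall_lt_succ_right, ← ih, ← hA.not_le, ← MTLAlgebra.himp_eq_one, eval_noChain_succ]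
    constructor
    · refine fun h => ⟨fun h' => h ?_, fun h' => h ?_⟩ <;> rw [h']
      · exact sup_eq_left.2 (MTLAlgebra.le_one _)
      · exact sup_eq_right.2 (MTLAlgebra.le_one _)
    · rintro ⟨h₁, h₂⟩ h
      exact (sup_eq_one_of_total hA.1 h).elim h₁ h₂

theorem IsDPChain.not_valid_noChain_iff {A : MTLAlg.{u}} (hA : A.IsDPChain) (n : ℕ) :
    ¬ A.Valid (noChain (n + 1)) ↔ ∃ S : Finset A, S.card = n + 2 := by
  let := hA.linearOrder
  constructor
  · intro h
    obtain ⟨v, hv⟩ := not_forall.1 h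
    have h01 : (⊥ : A) ≠ 1 := fun h01 => hv
      (le_antisymm (MTLAlgebra.le_one _) (h01.ge.trans bot_le))
    have hmono : StrictMono fun i : Fin (n + 2) => v i := by
      rw [Fin.strictMono_iff_lt_succ]
      intro i
      exact (hA.eval_noChain h01 v _).1 hv i i.2
    exact ⟨Finset.univ.map ⟨_, hmono.injective⟩, by simp⟩
  · rintro ⟨S, hS⟩ hval
    have h01 : (⊥ : A) ≠ 1 := by
      intro h01
      obtain ⟨x, -, y, -, hxy⟩ := Finset.one_lt_card.1 (by omega : 1 < S.card)
      exact hxy ((le_antisymm (MTLAlgebra.le_one x) (h01.ge.trans bot_le)).trans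
        (le_antisymm (MTLAlgebra.le_one y) (h01.ge.trans bot_le)).symm)
    let e := S.orderEmbOfFin hS
    refine (hA.eval_noChain h01 (fun i => if h : i < n + 2 then e ⟨i, h⟩ else ⊥) _).2 ?_ (hval _)
    intro i hi
    rw [dif_pos (by omega), dif_pos (by omega)]
    exact e.strictMono (by simp)

theorem exists_finset_card_iff {α : Type*} {n : ℕ} :
    (∃ S : Finset α, S.card = n + 1) ↔ ¬ (Finite α ∧ Nat.card α ≤ n) := by
  constructor
  · rintro ⟨S, hS⟩ ⟨hfin, hcard⟩
    have := Fintype.ofFinite α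
    have := S.card_le_univ
    rw [Nat.card_eq_fintype_card] at hcard
    omega
  · intro h
    rcases finite_or_infinite α with hfin | hinf
    · have := Fintype.ofFinite α
      have hcard : n + 1 ≤ (Finset.univ : Finset α).card := by
        rw [Finset.card_univ, ← Nat.card_eq_fintype_card]
        by_contra hlt
        exact h ⟨hfin, by omega⟩
      obtain ⟨S, -, hS⟩ := Finset.exists_subset_card_eq hcard
      exact ⟨S, hS⟩
    · exact Infinite.exists_subset_card_eq α _

theorem IsDPChain.valid_noChain_iff {A : MTLAlg.{u}} (hA : A.IsDPChain) (n : ℕ) :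
    A.Valid (noChain (n + 1)) ↔ Finite A ∧ Nat.card A ≤ n + 1 := by
  rw [← not_iff_not, hA.not_valid_noChain_iff, exists_finset_card_iff]

/-! ### Finite drastic product chains of every size -/

/-- The drastic product on a bounded linear order with a largest element below the top. -/
@[reducible]
def drasticProduct {α : Type*} [LinearOrder α] [BoundedOrder α] (c : α)
    (hc : ∀ z : α, z < ⊤ → z ≤ c ∧ c < ⊤) : MTLAlgebra α where
  __ := (inferInstance : Lattice α)
  __ := (inferInstance : BoundedOrder α)
  mul x y := if x = ⊤ then y else if y = ⊤ then x else ⊥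
  one := ⊤
  himp x y := if x ≤ y then ⊤ else if x = ⊤ then y else c
  mul_assoc x y z := by
    change (if (if x = ⊤ then y else if y = ⊤ then x else ⊥) = ⊤ then z else if z = ⊤ then
      (if x = ⊤ then y else if y = ⊤ then x else ⊥) else ⊥) = if x = ⊤ then
      (if y = ⊤ then z else if z = ⊤ then y else ⊥) else if
      (if y = ⊤ then z else if z = ⊤ then y else ⊥) = ⊤ then x else ⊥
    by_cases hx : x = ⊤
    · simp [hx]
    have hbot : (⊥ : α) ≠ ⊤ := (bot_le.trans_lt (lt_top_iff_ne_top.2 hx)).ne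
    by_cases hy : y = ⊤ <;> by_cases hz : z = ⊤ <;> simp [hx, hy, hz, hbot]
  one_mul x := if_pos rfl
  mul_one x := by
    change (if x = ⊤ then ⊤ else if (⊤ : α) = ⊤ then x else ⊥) = x
    by_cases h : x = ⊤ <;> simp [h]
  mul_comm x y := by
    change (if x = ⊤ then y else if y = ⊤ then x else ⊥) =
      if y = ⊤ then x else if x = ⊤ then y else ⊥
    by_cases hx : x = ⊤ <;> by_cases hy : y = ⊤ <;> simp [hx, hy]
  mul_le_iff_le_himp x y z := by
    change (if x = ⊤ then y else if y = ⊤ then x else ⊥) ≤ z ↔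
      x ≤ if y ≤ z then ⊤ else if y = ⊤ then z else c
    split_ifs with h1 h2 h3 h4 h5 h6
    · simp [h2]
    · simp [h1, h3]
    · simp only [h1, h2, false_iff, _root_.not_le]
      exact (hc y (lt_top_iff_ne_top.2 h3)).2
    · simp_all
    · rfl
    · simp
    · simpa using (hc x (lt_top_iff_ne_top.2 h1)).1
  one_eq_top := rfl
  prelinear x y := by
    change (if x ≤ y then ⊤ else if x = ⊤ then y else c) ⊔
      (if y ≤ x then ⊤ else if y = ⊤ then x else c) = ⊤
    rcases le_total x y with h | h <;> simp [h]

/-- The drastic product chain with `n + 1` elements. -/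
def stdChain (n : ℕ) : MTLAlg.{u} where
  carrier := ULift.{u} (Fin (n + 1))
  -- The coatom has index `n - 1`. For `n = 0` truncation makes this the top, which is harmless as
  -- nothing lies strictly below the top.
  str := drasticProduct ⟨⟨n - 1, by omega⟩⟩ fun z hz => by
    change z.down < Fin.last n at hz
    change z.down ≤ _ ∧ _ < Fin.last n
    rw [Fin.lt_def, Fin.val_last] at hz
    rw [Fin.le_def, Fin.lt_def, Fin.val_last]
    dsimp only
    omega

theorem isDPChain_stdChain (n : ℕ) : (stdChain.{u} n).IsDPChain := by
  refine isDPChain_of_valid (fun x y => le_total (α := ULift.{u} (Fin (n + 1))) x y) fun v => ?_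
  rw [eval_dpAxiom]
  by_cases h : v 0 = 1
  · rw [h]
    exact sup_eq_left.2 (MTLAlgebra.le_one _)
  · have hsq : v 0 * v 0 = ⊥ := (if_neg h).trans (if_neg h)
    rw [hsq, MTLAlgebra.himp_eq_one.2 le_rfl]
    exact sup_eq_right.2 (MTLAlgebra.le_one _)

theorem finite_stdChain (n : ℕ) : Finite (stdChain.{u} n) :=
  inferInstanceAs (Finite (ULift.{u} (Fin (n + 1))))

theorem card_stdChain (n : ℕ) : Nat.card (stdChain.{u} n) = n + 1 := by
  change Nat.card (ULift.{u} (Fin (n + 1))) = n + 1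
  simp

theorem valid_noChain_stdChain_iff {m n : ℕ} :
    (stdChain.{u} m).Valid (noChain (n + 1)) ↔ m ≤ n := by
  rw [(isDPChain_stdChain m).valid_noChain_iff, card_stdChain]
  simp [finite_stdChain]

end MTLAlg

/-! ### Subvarieties of the variety of drastic product algebras -/

namespace MTLAlg

open MTLFormula

theorem generated_subset {K V : Set MTLAlg.{u}} (hV : IsVariety V) (h : K ⊆ V) :
    generated K ⊆ V := Set.sInter_subset_of_mem ⟨hV, h⟩

theorem subset_generated (K : Set MTLAlg.{u}) : K ⊆ generated K :=
  Set.subset_sInter fun _ h => h.2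

theorem exists_isDPChain_not_valid {L : Set MTLFormula} (hL : dpAxiom ∈ L) {A : MTLAlg.{u}}
    (hA : A ∈ modelsOf L) {φ : MTLFormula} (hφ : ¬ A.Valid φ) :
    ∃ B : MTLAlg.{u}, B ∈ modelsOf L ∧ B.IsDPChain ∧ ¬ B.Valid φ := by
  obtain ⟨B, hB, htot, hBφ⟩ := exists_chain_not_valid hA hφ
  exact ⟨B, hB, isDPChain_of_valid htot (hB _ hL), hBφ⟩

theorem DP_eq_modelsOf : DP.{u} = modelsOf {dpAxiom} := by
  refine (generated_subset (isVariety_iff.2 ⟨_, rfl⟩) ?_).antisymm ?_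
  · rintro A hA _ rfl
    exact hA.valid_dpAxiom
  · rintro A hA V ⟨hV, hK⟩
    obtain ⟨L, rfl⟩ := isVariety_iff.1 hV
    intro φ hφ
    by_contra hAφ
    obtain ⟨B, -, hB, hBφ⟩ := exists_isDPChain_not_valid (Set.mem_singleton _) hA hAφ
    exact hBφ (hK hB φ hφ)

/-- Axioms of the proper subvarieties of `DP`, and of `DP` itself. -/
def subvarietyAxioms : WithTop ℕ → Set MTLFormula
  | ⊤ => {dpAxiom}
  | WithTop.some n => {dpAxiom, noChain (n + 1)}

/-- The variety whose chains are the drastic product chains with at most `n + 1` elements,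
respectively the variety `DP`. -/
def subvariety (a : WithTop ℕ) : Set MTLAlg.{u} := modelsOf (subvarietyAxioms a)

theorem isVariety_subvariety (a : WithTop ℕ) : IsVariety (subvariety.{u} a) :=
  isVariety_iff.2 ⟨_, rfl⟩

theorem subvariety_top : subvariety.{u} ⊤ = DP := DP_eq_modelsOf.symm

theorem dpAxiom_mem_subvarietyAxioms (a : WithTop ℕ) : dpAxiom ∈ subvarietyAxioms a := by
  induction a with
  | top => exact rfl
  | coe n => exact Or.inl rfl

theorem mem_subvariety_coe {A : MTLAlg.{u}} {n : ℕ} :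
    A ∈ subvariety (WithTop.some n) ↔ A.Valid dpAxiom ∧ A.Valid (noChain (n + 1)) := by
  constructor
  · exact fun h => ⟨h _ (Or.inl rfl), h _ (Or.inr rfl)⟩
  · rintro ⟨h₁, h₂⟩ φ (rfl | rfl)
    exacts [h₁, h₂]

theorem mem_subvariety_top {A : MTLAlg.{u}} : A ∈ subvariety ⊤ ↔ A.Valid dpAxiom :=
  ⟨fun h => h _ rfl, by rintro h _ rfl; exact h⟩

theorem subvariety_mono : Monotone subvariety.{u} := by
  intro a b hab A hA
  induction b with
  | top => exact mem_subvariety_top.2 (hA _ (dpAxiom_mem_subvarietyAxioms a))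
  | coe n =>
    obtain ⟨m, rfl⟩ := WithTop.ne_top_iff_exists.1 (ne_top_of_le_ne_top (WithTop.coe_ne_top) hab)
    rw [mem_subvariety_coe] at hA ⊢
    exact ⟨hA.1, hA.2.noChain_mono (Nat.succ_le_succ (WithTop.coe_le_coe.1 hab))⟩

theorem stdChain_mem_subvariety {m : ℕ} {a : WithTop ℕ} :
    stdChain.{u} m ∈ subvariety a ↔ WithTop.some m ≤ a := by
  induction a with
  | top => exact iff_of_true (mem_subvariety_top.2 (isDPChain_stdChain m).valid_dpAxiom) le_top
  | coe n =>
    rw [mem_subvariety_coe, valid_noChain_stdChain_iff, and_iff_right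
      (isDPChain_stdChain m).valid_dpAxiom]
    exact WithTop.coe_le_coe.symm

theorem subvariety_strictMono : StrictMono subvariety.{u} := by
  refine subvariety_mono.strictMono_of_injective fun a b hab => ?_
  by_contra hne
  wlog hlt : a < b generalizing a b
  · exact this b a hab.symm (Ne.symm hne) (lt_of_le_of_ne (not_lt.1 hlt) (Ne.symm hne))
  obtain ⟨m, rfl⟩ := WithTop.ne_top_iff_exists.1 hlt.ne_top
  -- This chain has `m + 2` elements, one too many for `subvariety m`.
  have h : stdChain.{u} (m + 1) ∈ subvariety b := stdChain_mem_subvariety.2 (by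
    induction b with
    | top => exact le_top
    | coe n => exact WithTop.coe_le_coe.2 (WithTop.coe_lt_coe.1 hlt))
  rw [← hab, stdChain_mem_subvariety] at h
  exact absurd (WithTop.coe_le_coe.1 h) (by simp)

/-- A variety contains `subvariety a` if it has sufficiently large drastic product chains. -/
theorem subvariety_subset {V : Set MTLAlg.{u}} (hV : IsVariety V) {a : WithTop ℕ}
    (h : ∀ B ∈ subvariety.{u} a, B.IsDPChain → ∀ S : Finset B,
      ∃ C ∈ V, C.IsDPChain ∧ ∃ T : Finset C, S.card ≤ T.card) : subvariety a ⊆ V := by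
  obtain ⟨L, rfl⟩ := isVariety_iff.1 hV
  intro A hA φ hφ
  by_contra hAφ
  obtain ⟨B, hBa, hB, hBφ⟩ := exists_isDPChain_not_valid (dpAxiom_mem_subvarietyAxioms a) hA hAφ
  obtain ⟨S, hS⟩ := hB.exists_finset hBφ
  obtain ⟨C, hCV, hC, T, hT⟩ := h B hBa hB S
  obtain ⟨T', -, hT'⟩ := Finset.exists_subset_card_eq hT
  exact hS C hC T' hT' (hCV φ hφ)

/-- DP-chains in `subvariety n` have at most `n + 1` elements, so the single chain `C` is large
enough for all refutations in them. -/
theorem subvariety_coe_subset {V : Set MTLAlg.{u}} (hV : IsVariety V) {n : ℕ} {C : MTLAlg.{u}}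
    (hCV : C ∈ V) (hC : C.IsDPChain) {T : Finset C} (hT : n + 1 ≤ T.card) :
    subvariety (WithTop.some n) ⊆ V := by
  refine subvariety_subset hV fun B hBn hB S => ⟨C, hCV, hC, T, ?_⟩
  by_contra hlt
  obtain ⟨S', -, hS'⟩ := Finset.exists_subset_card_eq (by omega : n + 2 ≤ S.card)
  exact (hB.not_valid_noChain_iff n).2 ⟨S', hS'⟩ (mem_subvariety_coe.1 hBn).2

/-- Every subvariety of `DP` is `DP` itself or one of the varieties `subvariety n`, and the latter
contains a drastic product chain with `n + 1` elements. -/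
theorem subvariety_classification {V : Set MTLAlg.{u}} (hV : IsVariety V) (hDP : V ⊆ DP) :
    V = subvariety ⊤ ∨ ∃ n : ℕ, V = subvariety (WithTop.some n) ∧
      ∃ C ∈ V, C.IsDPChain ∧ ∃ T : Finset C, n + 1 ≤ T.card := by
  classical
  rw [DP_eq_modelsOf] at hDP
  obtain ⟨L, rfl⟩ := isVariety_iff.1 hV
  have hlarge : ∀ n : ℕ, (¬ ∀ A ∈ modelsOf.{u} L, A.Valid (noChain (n + 1))) →
      ∃ C ∈ modelsOf.{u} L, C.IsDPChain ∧ ∃ T : Finset C, T.card = n + 2 := by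
    intro n h
    push Not at h
    obtain ⟨A, hA, hAn⟩ := h
    obtain ⟨C, hC, htot, hCn⟩ := exists_chain_not_valid hA hAn
    have hCDP := isDPChain_of_valid htot (hDP hC _ rfl)
    exact ⟨C, hC, hCDP, (hCDP.not_valid_noChain_iff n).1 hCn⟩
  by_cases h : ∃ n : ℕ, ∀ A ∈ modelsOf.{u} L, A.Valid (noChain (n + 1))
  · have hspec := Nat.find_spec h
    -- For the least bound `n = m + 1`, failure of the bound `m` yields a chain with `m + 2 = n + 1`
    -- elements.
    have hmin := fun m => Nat.find_min h (m := m)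
    generalize Nat.find h = n at hspec hmin
    obtain ⟨C, hCV, hC, T, hT⟩ : ∃ C ∈ modelsOf.{u} L, C.IsDPChain ∧
        ∃ T : Finset C, n + 1 ≤ T.card := by
      cases n with
      | zero =>
        -- No smaller bound can fail here, but the one-element chain lies in every variety.
        refine ⟨stdChain 0, fun φ _ v => ?_, isDPChain_stdChain 0, {1}, le_rfl⟩
        exact Subsingleton.elim (α := ULift (Fin 1)) _ _
      | succ m =>
        obtain ⟨C, hCV, hC, T, hT⟩ := hlarge m (hmin m m.lt_succ_self)
        exact ⟨C, hCV, hC, T, hT.ge⟩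
    refine Or.inr ⟨n, Set.Subset.antisymm (fun A hA => ?_) (subvariety_coe_subset hV hCV hC hT),
      C, hCV, hC, T, hT⟩
    exact mem_subvariety_coe.2 ⟨hDP hA _ rfl, hspec A hA⟩
  · push Not at h
    refine Or.inl (hDP.antisymm (subvariety_subset (a := ⊤) hV fun B _ _ S => ?_))
    obtain ⟨C, hCV, hC, T, hT⟩ := hlarge S.card (by push Not; exact h _)
    exact ⟨C, hCV, hC, T, by omega⟩

theorem exists_generated_eq {V : Set MTLAlg.{u}} (hV : IsVariety V) (hDP : V ⊂ DP) :
    ∃ C : MTLAlg.{u}, C.IsDPChain ∧ Finite C ∧ V = generated {C} := by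
  rcases subvariety_classification hV hDP.1 with rfl | ⟨n, rfl, C, hCV, hC, T, hT⟩
  · exact absurd subvariety_top hDP.ne
  · refine ⟨C, hC, ((hC.valid_noChain_iff n).1 (mem_subvariety_coe.1 hCV).2).1, ?_⟩
    refine Set.Subset.antisymm ?_ (generated_subset hV (Set.singleton_subset_iff.2 hCV))
    exact subvariety_coe_subset (isVariety_generated _) (subset_generated {C} rfl) hC hT

/-- The formula `noChain` with index `Nat.card C` is valid in `C`, hence throughout the variety
generated by `C`, and it bounds the size of `D`. -/
theorem card_le_of_mem_generated {C D : MTLAlg.{u}} (hC : C.IsDPChain) (hD : D.IsDPChain)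
    [Finite C] (h : D ∈ generated {C}) : Nat.card D ≤ Nat.card C := by
  have : Nonempty C := ⟨1⟩
  obtain ⟨n, hn⟩ := Nat.exists_eq_succ_of_ne_zero (Nat.card_pos (α := C)).ne'
  have hCn : C.Valid (noChain (n + 1)) := (hC.valid_noChain_iff n).2 ⟨inferInstance, hn.le⟩
  have hDn : D ∈ modelsOf {noChain (n + 1)} :=
    generated_subset (isVariety_iff.2 ⟨_, rfl⟩) (by rintro _ rfl _ rfl; exact hCn) h
  exact ((hD.valid_noChain_iff n).1 (hDn _ rfl)).2.trans hn.ge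

/-- The chain of the subvarieties of `DP`. -/
noncomputable def subvarietyOrderIso :
    {V : Set MTLAlg.{u} // IsVariety V ∧ V ⊆ DP} ≃o WithTop ℕ :=
  (StrictMono.orderIsoOfSurjective
    (fun a => ⟨subvariety a, isVariety_subvariety a,
      subvariety_top.{u} ▸ subvariety_mono le_top⟩ :
        WithTop ℕ → {V : Set MTLAlg.{u} // IsVariety V ∧ V ⊆ DP})
    (fun _ _ h => subvariety_strictMono h)
    (by
      rintro ⟨V, hV, hDP⟩
      rcases subvariety_classification hV hDP with rfl | ⟨n, rfl, -⟩
      · exact ⟨⊤, rfl⟩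
      · exact ⟨WithTop.some n, rfl⟩)).symm

end MTLAlg

/-! ### Axiomatic extensions -/

namespace MTLFormula

open MTLAlg

variable {Γ : Set MTLFormula}

theorem isTheory_derivable (Γ : Set MTLFormula) : IsTheory {φ | Derivable Γ φ} where
  ax := .ax
  mp := .mp

theorem subst_subst (σ τ : ℕ → MTLFormula) (φ : MTLFormula) :
    subst σ (subst τ φ) = subst (fun n => subst σ (τ n)) φ := by
  induction φ with
  | var n => rfl
  | bot => rfl
  | conj φ ψ ih₁ ih₂ => simp only [subst, ih₁, ih₂]
  | inf φ ψ ih₁ ih₂ => simp only [subst, ih₁, ih₂]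
  | imp φ ψ ih₁ ih₂ => simp only [subst, ih₁, ih₂]

theorem IsMTLAxiom.subst {φ : MTLFormula} (h : IsMTLAxiom φ) (σ : ℕ → MTLFormula) :
    IsMTLAxiom (φ.subst σ) := by
  cases h <;> constructor

theorem Derivable.subst {φ : MTLFormula} (h : Derivable Γ φ) (σ : ℕ → MTLFormula) :
    Derivable Γ (φ.subst σ) := by
  induction h with
  | ax h => exact .ax (h.subst σ)
  | inst τ h =>
    rw [subst_subst]
    exact .inst _ h
  | mp _ _ ih₁ ih₂ => exact .mp ih₁ ih₂

theorem Derivable.valid {φ : MTLFormula} (h : Derivable Γ φ) {A : MTLAlg.{u}}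
    (hA : A ∈ modelsOf Γ) : A.Valid φ := by
  induction h with
  | ax h => exact fun v => MTLAlgebra.eval_axiom v h
  | inst σ h => exact fun v => (MTLAlgebra.eval_subst v σ _).trans (hA _ h _)
  | mp _ _ ih₁ ih₂ =>
    intro v
    have h : _ ⇨ _ = (1 : A) := ih₂ v
    rw [MTLAlgebra.himp_eq_one, ih₁ v] at h
    exact le_antisymm (MTLAlgebra.le_one _) h

/-- Completeness: the formulas valid in all models of a logic are theorems of the logic. -/
theorem derivable_of_valid {φ : MTLFormula}
    (h : ∀ A ∈ modelsOf.{u} {ψ | Derivable Γ ψ}, A.Valid φ) : Derivable Γ φ := by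
  have hT := isTheory_derivable Γ
  have hφ := h ⟨hT.Lindenbaum⟩ (by
    intro ψ hψ w
    choose σ hσ using fun n => hT.cls_surjective (w n)
    obtain rfl : (fun n => hT.cls (σ n)) = w := funext hσ
    -- Theorems are closed under substitution, so the Lindenbaum algebra is a model of the logic.
    exact (hT.eval_cls σ ψ).trans (hT.cls_eq_one.2 (hψ.subst σ))) fun n => hT.cls (var n)
  have hφ' := (hT.eval_cls var φ).symm.trans hφ
  rwa [subst_var, hT.cls_eq_one] at hφ'

/-- The formulas valid in all members of a class of algebras. -/
def theoryOf (V : Set MTLAlg.{u}) : Set MTLFormula := {φ | ∀ A ∈ V, A.Valid φ}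

theorem modelsOf_theoryOf {V : Set MTLAlg.{u}} (hV : IsVariety V) : modelsOf (theoryOf V) = V := by
  obtain ⟨L, rfl⟩ := isVariety_iff.1 hV
  exact Set.Subset.antisymm (fun A hA φ hφ => hA φ fun B hB => hB φ hφ)
    fun A hA φ hφ => hφ A hA

theorem IsAxiomaticExtensionOfDP.theoryOf_modelsOf {L : Set MTLFormula}
    (hL : IsAxiomaticExtensionOfDP L) : theoryOf (modelsOf.{u} L) = L := by
  obtain ⟨Γ, rfl⟩ := hL
  exact Set.Subset.antisymm (fun φ hφ => derivable_of_valid hφ) fun φ hφ A hA => hA φ hφ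

theorem IsAxiomaticExtensionOfDP.modelsOf_subset {L : Set MTLFormula}
    (hL : IsAxiomaticExtensionOfDP L) : modelsOf.{u} L ⊆ DP := by
  obtain ⟨Γ, rfl⟩ := hL
  rw [DP_eq_modelsOf]
  rintro A hA _ rfl
  refine hA _ ?_
  have h : Derivable ({dpAxiom} ∪ Γ) (subst var dpAxiom) := .inst var (Or.inl rfl)
  rwa [subst_var] at h

/-- The theory serves as its own set of axioms; by soundness it derives nothing new. -/
theorem isAxiomaticExtensionOfDP_theoryOf {V : Set MTLAlg.{u}} (hV : V ⊆ DP) :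
    IsAxiomaticExtensionOfDP (theoryOf V) := by
  rw [DP_eq_modelsOf] at hV
  refine ⟨theoryOf V, Set.Subset.antisymm (fun φ hφ => ?_) fun φ hφ A hA => ?_⟩
  · have h : Derivable ({dpAxiom} ∪ theoryOf V) (subst var φ) := .inst var (Or.inr hφ)
    rwa [subst_var] at h
  · refine Derivable.valid hφ ?_
    rintro ψ (rfl | hψ)
    · exact hV hA _ rfl
    · exact hψ A hA

/-- The axiomatic extensions of DP correspond to the subvarieties of `DP`. -/
def axiomaticExtensionOrderIso : {L : Set MTLFormula // IsAxiomaticExtensionOfDP L} ≃o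
    {V : Set MTLAlg.{u} // IsVariety V ∧ V ⊆ DP}ᵒᵈ where
  toFun L := OrderDual.toDual ⟨modelsOf L.1, isVariety_iff.2 ⟨_, rfl⟩, L.2.modelsOf_subset⟩
  invFun V := ⟨theoryOf (OrderDual.ofDual V).1,
    isAxiomaticExtensionOfDP_theoryOf (OrderDual.ofDual V).2.2⟩
  left_inv L := Subtype.ext L.2.theoryOf_modelsOf
  right_inv V := Subtype.ext (modelsOf_theoryOf (OrderDual.ofDual V).2.1)
  map_rel_iff' {L M} := by
    change modelsOf M.1 ⊆ modelsOf L.1 ↔ L.1 ⊆ M.1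
    refine ⟨fun h => ?_, fun h A hA φ hφ => hA φ (h hφ)⟩
    rw [← M.2.theoryOf_modelsOf.{u}, ← L.2.theoryOf_modelsOf.{u}]
    exact fun φ hφ A hA => hφ A (h hA)

end MTLFormula

theorem theorem5p5 :
    -- every proper subvariety of `DP` is generated by a single finite DP-chain
    (∀ V : Set MTLAlg.{u}, MTLAlg.IsVariety V → V ⊂ MTLAlg.DP →
      ∃ C : MTLAlg.{u}, C.IsDPChain ∧ Finite C ∧ V = MTLAlg.generated {C}) ∧
    -- finite DP-chains of different cardinality generate distinct subvarieties
    (∀ C D : MTLAlg.{u}, C.IsDPChain → D.IsDPChain → Finite C → Finite D →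
      Nat.card C ≠ Nat.card D → MTLAlg.generated {C} ≠ MTLAlg.generated {D}) ∧
    -- the subvarieties of `DP`, ordered by inclusion, form a chain of order type `ω + 1`
    Nonempty ({V : Set MTLAlg.{u} // MTLAlg.IsVariety V ∧ V ⊆ MTLAlg.DP} ≃o WithTop ℕ) ∧
    -- the axiomatic extensions of the logic DP, ordered by reverse inclusion, do so as well
    Nonempty ({L : Set MTLFormula // MTLFormula.IsAxiomaticExtensionOfDP L} ≃o
      (WithTop ℕ)ᵒᵈ) := by
  refine ⟨fun V hV hDP => MTLAlg.exists_generated_eq hV hDP, ?_, ⟨MTLAlg.subvarietyOrderIso⟩,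
    -- Logics involve no universe, so their models may be taken in universe `0`.
    ⟨MTLFormula.axiomaticExtensionOrderIso.{0}.trans MTLAlg.subvarietyOrderIso.dual⟩⟩
  intro C D hC hD _ _ hne h
  exact hne (le_antisymm
    (MTLAlg.card_le_of_mem_generated hD hC (h ▸ MTLAlg.subset_generated {C} rfl))
    (MTLAlg.card_le_of_mem_generated hC hD (h ▸ MTLAlg.subset_generated {D} rfl)))
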